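/- Let $n\ge 0$, let $X,Y\in M_{n\times n}(\mathbb{C})$, $\alpha>0$, $p>1$ and $q=\frac{p}{p-1}$. For a matrix $A$ put $|A|=(A^*A)^{1/2}$. Let $|||\cdot|||$ be any unitarily invariant norm on $M_{n\times n}(\mathbb{C})$, that is, a norm with $|||UAV|||=|||A|||$ for all matrices $A$ and all unitary $U,V$. Then $$|||\,|XY|^{\alpha}\,||| = \inf_{Z\ \mathrm{invertible}}\left\{|||\,|XZ|^{\alpha p}\,|||^{1/p}\;|||\,|Z^{-1}Y|^{\alpha q}\,|||^{1/q}\right\} = \inf_{Z\ \mathrm{invertible}}\left\{\frac1p\,|||\,|XZ|^{\alpha p}\,||| + \frac1q\,|||\,|Z^{-1}Y|^{\alpha q}\,|||\right\},$$ where $Z$ runs over the invertible matrices in $M_{n\times n}(\mathbb{C})$. If $X$ and $Y$ are both invertible, then both infima are minima. -/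

import Mathlib

/-- A unitarily invariant norm on the `n × n` complex matrices: a norm on the complex vector space
of matrices with `|||U A V||| = |||A|||` for all unitary `U`, `V`. (A `Seminorm ℂ` is subadditive
and absolutely homogeneous, hence nonnegative with value `0` at `0`.) -/
structure UnitarilyInvariantNorm (n : ℕ) extends Seminorm ℂ (Matrix (Fin n) (Fin n) ℂ) where
  /-- The seminorm is definite, that is, a norm. -/
  eq_zero_of_map_eq_zero : ∀ A : Matrix (Fin n) (Fin n) ℂ, toFun A = 0 → A = 0
  /-- Invariance under multiplication by unitary matrices on both sides. -/
  unitary_invariant : ∀ U V A : Matrix (Fin n) (Fin n) ℂ,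
    U ∈ Matrix.unitaryGroup (Fin n) ℂ → V ∈ Matrix.unitaryGroup (Fin n) ℂ →
      toFun (U * A * V) = toFun A

/-- A unitarily invariant norm is used as a function on matrices. -/
instance (n : ℕ) : CoeFun (UnitarilyInvariantNorm n)
    (fun _ => Matrix (Fin n) (Fin n) ℂ → ℝ) where
  coe N := N.toFun

open scoped MatrixOrder in
/-- The power `|X| ^ s` of the absolute value `|X| = (X* X)^{1/2}` of a square complex matrix, in
the sense of the functional calculus. -/
noncomputable def matrixAbsPow {n : ℕ} (X : Matrix (Fin n) (Fin n) ℂ) (s : ℝ) :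
    Matrix (Fin n) (Fin n) ℂ :=
  CFC.rpow (CFC.abs X) s

open scoped ComplexOrder

/-! By unitary invariance $|||\,|A|^r\,|||$ is the norm of the diagonal matrix of the $r$-th powers
of the singular values of $A$, so everything reduces to singular values.

Lower bound: this is a Hölder inequality for the factorization $XY=(XZ)(Z^{-1}Y)$. Horn's inequality
(`prod_singular_values_mul_le`) says that the singular values of $AB$ are log-majorized by the
products $s_it_i$; hence their powers are weakly majorized, and Ky Fan dominance
(`realDiagonal_le_of_forall_weights`) turns this into a norm inequality. Young's inequality, applied
entrywise, finishes the diagonal case (`realDiagonal_mul_le`). The weighted AM-GM inequality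
transfers the bound from the product to the sum.

Attainment: if $X,Y$ are invertible and $XY=UDV$, take $Z=X^{-1}UD^{1/p}V$. Then $XZ=UD^{1/p}V$ and
$Z^{-1}Y=V^*D^{1/q}V$, so both norms equal $|||D^\alpha|||$, and both infima are attained at this
$Z$. For general $X,Y$, add $\varepsilon$ to the singular values. Since $X=KX_\varepsilon$ and
$Y=Y_\varepsilon L$ with contractions $K,L$, the optimal $Z$ for $X_\varepsilon,Y_\varepsilon$ is
almost optimal for $X,Y$. -/

/-- The diagonal complex matrix with the given real entries. -/
noncomputable def realDiagonal {n : ℕ} (d : Fin n → ℝ) : Matrix (Fin n) (Fin n) ℂ :=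
  Matrix.diagonal fun i => (d i : ℂ)

/-! ### Algebra of real diagonal matrices -/

section RealDiagonal

variable {n : ℕ}

lemma realDiagonal_mul (c d : Fin n → ℝ) :
    realDiagonal c * realDiagonal d = realDiagonal (fun i => c i * d i) := by
  simp [realDiagonal, Matrix.diagonal_mul_diagonal]

lemma realDiagonal_add (c d : Fin n → ℝ) :
    realDiagonal c + realDiagonal d = realDiagonal (c + d) := by
  simp [realDiagonal, Matrix.diagonal_add]

lemma realDiagonal_sub (c d : Fin n → ℝ) :
    realDiagonal c - realDiagonal d = realDiagonal (c - d) := by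
  simp [realDiagonal, Matrix.diagonal_sub]

lemma realDiagonal_smul (c : ℝ) (d : Fin n → ℝ) :
    realDiagonal (c • d) = (c : ℂ) • realDiagonal d := by
  ext i j
  by_cases h : i = j <;> simp [realDiagonal, h]

lemma realDiagonal_one : realDiagonal (fun _ : Fin n => 1) = 1 := by
  simp [realDiagonal]

lemma realDiagonal_star (d : Fin n → ℝ) : star (realDiagonal d) = realDiagonal d := by
  rw [Matrix.star_eq_conjTranspose, realDiagonal, Matrix.diagonal_conjTranspose]
  congr 1
  ext i
  simp

lemma isUnit_realDiagonal {d : Fin n → ℝ} (hd : ∀ i, d i ≠ 0) : IsUnit (realDiagonal d) := by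
  rw [realDiagonal, Matrix.isUnit_diagonal, Pi.isUnit_iff]
  intro i
  simpa using hd i

lemma ne_zero_of_isUnit_realDiagonal {d : Fin n → ℝ} (hd : IsUnit (realDiagonal d)) (i : Fin n) :
    d i ≠ 0 := by
  rw [realDiagonal, Matrix.isUnit_diagonal, Pi.isUnit_iff] at hd
  simpa using hd i

end RealDiagonal

/-! ### Majorization and Ky Fan dominance -/

section Dominance

/-- **Abel summation**: if the partial sums of `d` are nonnegative, then so is `∑ i, w i * d i` for
every antitone nonnegative `w`. -/
lemma sum_mul_nonneg_of_antitone {n : ℕ} (w d : Fin n → ℝ) (hw : Antitone w) (hw0 : ∀ i, 0 ≤ w i)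
    (hd : ∀ (k : ℕ) (hk : k ≤ n), 0 ≤ ∑ j : Fin k, d (Fin.castLE hk j)) :
    0 ≤ ∑ i, w i * d i := by
  induction n with
  | zero => simp
  | succ n ih =>
    -- Subtracting the last weight from the others keeps them antitone and nonnegative, so induction
    -- applies; the remainder is the last weight times the full sum.
    have h1 : ∑ i, w i * d i =
        ∑ i : Fin n, (w i.castSucc - w (Fin.last n)) * d i.castSucc + w (Fin.last n) * ∑ i, d i := by
      rw [Fin.sum_univ_castSucc, Fin.sum_univ_castSucc d, mul_add, Finset.mul_sum, ← add_assoc,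
        ← Finset.sum_add_distrib]
      congr 1
      exact Finset.sum_congr rfl fun i _ => by ring
    rw [h1]
    refine add_nonneg (ih (fun i => w i.castSucc - w (Fin.last n)) (fun i => d i.castSucc) ?_ ?_ ?_)
      (mul_nonneg (hw0 _) (by simpa using hd (n + 1) le_rfl))
    · intro i j hij
      have := hw (Fin.castSucc_le_castSucc_iff.2 hij)
      simpa using this
    · intro i
      simpa using hw (Fin.le_last i.castSucc)
    · intro k hk
      exact hd k (hk.trans n.le_succ)

/-- Log-majorization implies majorization, tested against antitone nonnegative weights. -/
lemma sum_mul_le_sum_mul_of_prod_le {n : ℕ} (w x y : Fin n → ℝ) (hw : Antitone w)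
    (hw0 : ∀ i, 0 ≤ w i) (hx : Antitone x) (hx0 : ∀ i, 0 < x i) (hy0 : ∀ i, 0 < y i)
    (h : ∀ (k : ℕ) (hk : k ≤ n),
      ∏ j : Fin k, x (Fin.castLE hk j) ≤ ∏ j : Fin k, y (Fin.castLE hk j)) :
    ∑ i, w i * x i ≤ ∑ i, w i * y i := by
  -- The factor `x i` joins the weight because $x\log(y/x)\le y-x$; the product `w i * x i` is still
  -- antitone.
  have key := sum_mul_nonneg_of_antitone (fun i => w i * x i)
    (fun i => Real.log (y i) - Real.log (x i))
    (fun i j hij => mul_le_mul (hw hij) (hx hij) (hx0 _).le (hw0 _))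
    (fun i => mul_nonneg (hw0 i) (hx0 i).le) (fun k hk => by
      rw [Finset.sum_sub_distrib, sub_nonneg, ← Real.log_prod fun i _ => (hx0 _).ne',
        ← Real.log_prod fun i _ => (hy0 _).ne']
      exact Real.log_le_log (Finset.prod_pos fun i _ => hx0 _) (h k hk))
  rw [← sub_nonneg, ← Finset.sum_sub_distrib]
  refine key.trans (Finset.sum_le_sum fun i _ => ?_)
  rw [← mul_sub, mul_assoc]
  refine mul_le_mul_of_nonneg_left ?_ (hw0 i)
  rw [← Real.log_div (hy0 i).ne' (hx0 i).ne']
  have h1 := Real.log_le_sub_one_of_pos (div_pos (hy0 i) (hx0 i))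
  calc x i * Real.log (y i / x i) ≤ x i * (y i / x i - 1) := mul_le_mul_of_nonneg_left h1 (hx0 i).le
    _ = y i - x i := by field_simp [(hx0 i).ne']

variable {n : ℕ} (N : UnitarilyInvariantNorm n)

namespace UnitarilyInvariantNorm

lemma nonneg (A : Matrix (Fin n) (Fin n) ℂ) : 0 ≤ N A := apply_nonneg N.toSeminorm A

lemma add_le (A B : Matrix (Fin n) (Fin n) ℂ) : N (A + B) ≤ N A + N B :=
  map_add_le_add N.toSeminorm A B

lemma smul (c : ℂ) (A : Matrix (Fin n) (Fin n) ℂ) : N (c • A) = ‖c‖ * N A :=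
  map_smul_eq_mul N.toSeminorm c A

lemma conj_apply {U : Matrix (Fin n) (Fin n) ℂ} (hU : U ∈ Matrix.unitaryGroup (Fin n) ℂ)
    (A : Matrix (Fin n) (Fin n) ℂ) : N (star U * A * U) = N A :=
  N.unitary_invariant _ _ _ (Unitary.star_mem hU) hU

lemma realDiagonal_smul {c : ℝ} (hc : 0 ≤ c) (d : Fin n → ℝ) :
    N (realDiagonal (c • d)) = c * N (realDiagonal d) := by
  rw [_root_.realDiagonal_smul, N.smul, Complex.norm_real, Real.norm_of_nonneg hc]

/-- Permutation matrices and diagonal sign matrices are unitary: conjugate by the former, then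
multiply on the left by the latter. -/
lemma realDiagonal_perm_sign (σ : Equiv.Perm (Fin n)) (ε y : Fin n → ℝ) (hε : ∀ i, ε i * ε i = 1) :
    N (realDiagonal fun i => ε i * y (σ i)) = N (realDiagonal y) := by
  have h1 : realDiagonal (fun i => ε i * y (σ i)) =
      (realDiagonal ε * σ.permMatrix ℂ) * realDiagonal y * star (σ.permMatrix ℂ) := by
    have h2 : σ.permMatrix ℂ * realDiagonal y * star (σ.permMatrix ℂ) =
        realDiagonal (fun i => y (σ i)) := by
      rw [Matrix.star_eq_conjTranspose, Matrix.conjTranspose_permMatrix]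
      rw [Equiv.Perm.permMatrix, Equiv.Perm.permMatrix, PEquiv.toMatrix_toPEquiv_mul,
        PEquiv.mul_toMatrix_toPEquiv]
      have h3 : Equiv.symm σ⁻¹ = σ := rfl
      ext i j
      simp [realDiagonal, Matrix.diagonal_apply, h3]
    rw [Matrix.mul_assoc, Matrix.mul_assoc, ← Matrix.mul_assoc (σ.permMatrix ℂ), h2,
      realDiagonal_mul]
  have hP : σ.permMatrix ℂ ∈ Matrix.unitaryGroup (Fin n) ℂ := by
    rw [Matrix.mem_unitaryGroup_iff, Matrix.star_eq_conjTranspose, Matrix.conjTranspose_permMatrix,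
      ← Matrix.permMatrix_mul]
    simp
  have hE : realDiagonal ε ∈ Matrix.unitaryGroup (Fin n) ℂ := by
    rw [Matrix.mem_unitaryGroup_iff, realDiagonal_star, realDiagonal_mul]
    simp only [hε, realDiagonal_one]
  rw [h1]
  exact N.unitary_invariant _ _ _ (mul_mem hE hP) (Unitary.star_mem hP)

/-- **Ky Fan dominance** for diagonal matrices, with majorization expressed by antitone nonnegative
weights. -/
lemma realDiagonal_le_of_forall_weights {x y : Fin n → ℝ} (hx : Antitone x) (hx0 : ∀ i, 0 ≤ x i)
    (h : ∀ w : Fin n → ℝ, Antitone w → (∀ i, 0 ≤ w i) → ∑ i, w i * x i ≤ ∑ i, w i * y i) :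
    N (realDiagonal x) ≤ N (realDiagonal y) := by
  -- Hahn–Banach: a linear functional dominated by the norm and attaining it at `x`. Extension
  -- starts from the span of `x`, so `x = 0` is separate.
  obtain ⟨g, hg1, hg2⟩ : ∃ g : (Fin n → ℝ) →ₗ[ℝ] ℝ,
      g x = N (realDiagonal x) ∧ ∀ z, g z ≤ N (realDiagonal z) := by
    by_cases hx' : x = 0
    · refine ⟨0, ?_, fun z => N.nonneg _⟩
      have : N (realDiagonal x) = 0 := by
        have := N.realDiagonal_smul le_rfl x
        rwa [zero_smul, zero_mul, ← hx'] at this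
      simp [this]
    · obtain ⟨g, hg1, hg2⟩ := exists_extension_of_le_sublinear
        (LinearPMap.mkSpanSingleton (K := ℝ) x (N (realDiagonal x)) hx')
        (fun z => N (realDiagonal z)) (fun c hc z => N.realDiagonal_smul hc.le z)
        (fun z z' => by
          rw [← realDiagonal_add]
          exact N.add_le _ _) (by
          rintro ⟨z, hz⟩
          obtain ⟨c, rfl⟩ := Submodule.mem_span_singleton.1 hz
          rw [LinearPMap.mkSpanSingleton'_apply, smul_eq_mul, RingHom.id_apply]
          dsimp only
          rcases le_total 0 c with hc | hc
          · rw [N.realDiagonal_smul hc]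
          · exact (mul_nonpos_of_nonpos_of_nonneg hc (N.nonneg _)).trans (N.nonneg _))
      refine ⟨g, ?_, hg2⟩
      have := hg1 ⟨x, Submodule.mem_span_singleton_self x⟩
      exact this.trans (LinearPMap.mkSpanSingleton_apply ℝ ℝ hx' (N (realDiagonal x)))
  set b : Fin n → ℝ := fun i => g (Pi.single i 1) with hb
  have hgb : ∀ z, g z = ∑ i, b i * z i := by
    intro z
    conv_lhs => rw [pi_eq_sum_univ' z]
    simp [map_sum, hb, mul_comm]
  -- The coefficients of `g`, in absolute value and sorted decreasingly by `τ`, are the test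
  -- weights. Rearrangement bounds `g x` by them; the signs `ε` and `τ⁻¹` then turn the weighted sum
  -- of `y` back into a value of `g` at a signed permutation of `y`.
  set τ : Equiv.Perm (Fin n) := Tuple.sort fun i => -|b i| with hτ
  have hw : Antitone fun i => |b (τ i)| := by
    intro i j hij
    have := Tuple.monotone_sort (fun i => -|b i|) hij
    simpa using this
  set ε : Fin n → ℝ := fun i => if b i < 0 then -1 else 1 with hε
  have hε1 : ∀ i, ε i * ε i = 1 := by
    intro i
    by_cases hi : b i < 0 <;> simp [hε, hi]
  have hε2 : ∀ i, b i * ε i = |b i| := by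
    intro i
    by_cases hi : b i < 0
    · simp [hε, hi, abs_of_neg hi]
    · simp [hε, hi, abs_of_nonneg (not_lt.1 hi)]
  calc N (realDiagonal x) = ∑ i, b i * x i := by rw [← hg1, hgb]
    _ ≤ ∑ i, |b i| * x i :=
      Finset.sum_le_sum fun i _ => mul_le_mul_of_nonneg_right (le_abs_self _) (hx0 i)
    _ ≤ ∑ i, |b (τ i)| * x i := by
      have h3 := (hw.monovary hx).sum_comp_perm_mul_le_sum_mul (σ := τ⁻¹)
      simpa using h3
    _ ≤ ∑ i, |b (τ i)| * y i := h _ hw fun i => abs_nonneg _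
    _ = ∑ i, |b i| * y (τ⁻¹ i) := by
      rw [← Equiv.sum_comp τ fun i => |b i| * y (τ⁻¹ i)]
      simp
    _ = g fun i => ε i * y (τ⁻¹ i) := by
      rw [hgb]
      exact Finset.sum_congr rfl fun i _ => by rw [← mul_assoc, hε2]
    _ ≤ N (realDiagonal fun i => ε i * y (τ⁻¹ i)) := hg2 _
    _ = N (realDiagonal y) := N.realDiagonal_perm_sign _ _ _ hε1

lemma realDiagonal_mono {x y : Fin n → ℝ} (hx : Antitone x) (hx0 : ∀ i, 0 ≤ x i) (h : x ≤ y) :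
    N (realDiagonal x) ≤ N (realDiagonal y) :=
  N.realDiagonal_le_of_forall_weights hx hx0 fun _ _ hw0 =>
    Finset.sum_le_sum fun i _ => mul_le_mul_of_nonneg_left (h i) (hw0 i)

/-- Expanding in matrix units bounds the norm by a continuous function of the entries vanishing at
`0`; a seminorm continuous at `0` is continuous. -/
lemma continuous : Continuous fun A : Matrix (Fin n) (Fin n) ℂ => N A := by
  refine Seminorm.continuous_of_continuousAt_zero (p := N.toSeminorm) ?_
  have h : ∀ A : Matrix (Fin n) (Fin n) ℂ,
      N.toSeminorm A ≤ ∑ i, ∑ j, ‖A i j‖ * N.toSeminorm (Matrix.single i j 1) := by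
    intro A
    conv_lhs => rw [Matrix.matrix_eq_sum_single A]
    refine (Finset.le_sum_of_subadditive N.toSeminorm (map_zero _).le (map_add_le_add _) _ _).trans
      (Finset.sum_le_sum fun i _ => ?_)
    refine (Finset.le_sum_of_subadditive N.toSeminorm (map_zero _).le (map_add_le_add _) _ _).trans
      (Finset.sum_le_sum fun j _ => ?_)
    rw [← map_smul_eq_mul N.toSeminorm, Matrix.smul_single, smul_eq_mul, mul_one]
  rw [ContinuousAt, map_zero]
  refine squeeze_zero (fun A => apply_nonneg _ _) h ?_
  have : Continuous fun A : Matrix (Fin n) (Fin n) ℂ =>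
      ∑ i, ∑ j, ‖A i j‖ * N.toSeminorm (Matrix.single i j 1) := by fun_prop
  simpa using this.tendsto 0

end UnitarilyInvariantNorm

end Dominance

/-! ### Singular values and powers of the absolute value -/

section Decomposition

variable {n : ℕ}

/-- The column vectors of a matrix `A` with `Aᴴ * A` diagonal can be normalized to an orthonormal
basis. -/
lemma exists_unitary_mul_realDiagonal (A : Matrix (Fin n) (Fin n) ℂ) (s : Fin n → ℝ)
    (hA : star A * A = realDiagonal fun i => s i * s i) :
    ∃ U ∈ Matrix.unitaryGroup (Fin n) ℂ, A = U * realDiagonal s := by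
  set a : Fin n → EuclideanSpace ℂ (Fin n) := fun j => WithLp.toLp 2 fun i => A i j with ha
  have hinner : ∀ i j, inner ℂ (a i) (a j) = if i = j then ((s i * s i : ℝ) : ℂ) else 0 := by
    intro i j
    have h1 := congrFun (congrFun hA i) j
    rw [realDiagonal, Matrix.diagonal_apply, Matrix.mul_apply] at h1
    rw [← h1]
    simp [ha, PiLp.inner_apply, mul_comm]
  -- Only the nonzero columns can be normalized; basis vectors at indices with `s i = 0` come from
  -- the extension and do not matter.
  have hv : Orthonormal ℂ (Set.domRestrict {i | s i ≠ 0} fun i => ((s i)⁻¹ : ℂ) • a i) := by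
    rw [orthonormal_iff_ite]
    rintro ⟨i, hi⟩ ⟨j, hj⟩
    simp only [Set.domRestrict_apply, inner_smul_left, inner_smul_right, hinner, Subtype.mk.injEq]
    by_cases hij : i = j
    · subst hij
      have hi' : (s i : ℂ) ≠ 0 := by exact_mod_cast hi
      simp
      field_simp
    · simp [hij]
  obtain ⟨b, hb⟩ := hv.exists_orthonormalBasis_extension_of_card_eq (by simp)
  have hab : ∀ j, a j = (s j : ℂ) • b j := by
    intro j
    by_cases hj : s j = 0
    · have h1 := hinner j j
      simp only [hj, if_true, mul_zero, Complex.ofReal_zero, inner_self_eq_zero] at h1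
      simp [h1, hj]
    · have hj' : (s j : ℂ) ≠ 0 := by exact_mod_cast hj
      rw [hb j hj, smul_smul, mul_inv_cancel₀ hj', one_smul]
  refine ⟨Matrix.of fun i j => b j i, ?_, ?_⟩
  · rw [Matrix.mem_unitaryGroup_iff']
    ext i j
    have h1 := (orthonormal_iff_ite.1 b.orthonormal) i j
    rw [Matrix.mul_apply, Matrix.one_apply, ← h1]
    simp [PiLp.inner_apply, mul_comm]
  · ext i j
    have h1 := congrArg (fun v : EuclideanSpace ℂ (Fin n) => v i) (hab j)
    simp only [ha, PiLp.smul_apply, smul_eq_mul] at h1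
    simp [realDiagonal, h1, mul_comm]

/-- **Singular value decomposition** of a square complex matrix. -/
lemma exists_singular_value_decomposition (X : Matrix (Fin n) (Fin n) ℂ) :
    ∃ U ∈ Matrix.unitaryGroup (Fin n) ℂ, ∃ V ∈ Matrix.unitaryGroup (Fin n) ℂ, ∃ s : Fin n → ℝ,
      Antitone s ∧ (∀ i, 0 ≤ s i) ∧ X = U * realDiagonal s * V := by
  have hH := Matrix.posSemidef_conjTranspose_mul_self X
  set μ := hH.isHermitian.eigenvalues with hμ
  have hμ0 : ∀ i, 0 ≤ μ i := hH.eigenvalues_nonneg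
  set τ : Equiv.Perm (Fin n) := Tuple.sort fun i => -μ i with hτ
  set s : Fin n → ℝ := fun i => √(μ (τ i)) with hs
  have hanti : Antitone s := by
    intro i j hij
    have := Tuple.monotone_sort (fun i => -μ i) hij
    exact Real.sqrt_le_sqrt (by simpa using this)
  set W : Matrix (Fin n) (Fin n) ℂ := hH.isHermitian.eigenvectorUnitary.1 with hW
  have hWu : W ∈ Matrix.unitaryGroup (Fin n) ℂ := hH.isHermitian.eigenvectorUnitary.2
  have hspec : star W * (star X * X) * W = realDiagonal μ := by
    have h1 := hH.isHermitian.spectral_theorem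
    rw [Unitary.conjStarAlgAut_apply] at h1
    have h2 : star X * X = W * realDiagonal μ * star W := h1
    rw [h2]
    have h3 := Matrix.mem_unitaryGroup_iff'.1 hWu
    simp only [← Matrix.mul_assoc, h3, Matrix.one_mul]
    rw [Matrix.mul_assoc, h3, Matrix.mul_one]
  set P : Matrix (Fin n) (Fin n) ℂ := (τ⁻¹).permMatrix ℂ with hP
  have hPs : star P = τ.permMatrix ℂ := by
    rw [Matrix.star_eq_conjTranspose, Matrix.conjTranspose_permMatrix, inv_inv]
  have hPu : P ∈ Matrix.unitaryGroup (Fin n) ℂ := by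
    rw [Matrix.mem_unitaryGroup_iff, hPs, ← Matrix.permMatrix_mul]
    simp
  have hQ : star P * realDiagonal μ * P = realDiagonal fun i => s i * s i := by
    rw [hPs, hP, Equiv.Perm.permMatrix, Equiv.Perm.permMatrix, PEquiv.toMatrix_toPEquiv_mul,
      PEquiv.mul_toMatrix_toPEquiv]
    have h3 : Equiv.symm τ⁻¹ = τ := rfl
    ext i j
    simp [realDiagonal, Matrix.diagonal_apply, h3, hs, Real.mul_self_sqrt (hμ0 _)]
  -- In the sorted eigenbasis `W * P` of `star X * X`, the Gram matrix of the columns is diagonal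
  -- with entries `s i * s i`.
  obtain ⟨U, hU, hXU⟩ := exists_unitary_mul_realDiagonal (X * (W * P)) s (by
      rw [← hQ, ← hspec]
      simp only [star_mul, Matrix.mul_assoc])
  refine ⟨U, hU, star (W * P), Unitary.star_mem (mul_mem hWu hPu), s, hanti,
    fun i => Real.sqrt_nonneg _, ?_⟩
  rw [← hXU, Matrix.mul_assoc, Matrix.mem_unitaryGroup_iff.1 (mul_mem hWu hPu), Matrix.mul_one]

open scoped MatrixOrder in
/-- The power of the absolute value in terms of a singular value decomposition. -/
lemma matrixAbsPow_eq {U V : Matrix (Fin n) (Fin n) ℂ} (hU : U ∈ Matrix.unitaryGroup (Fin n) ℂ)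
    (hV : V ∈ Matrix.unitaryGroup (Fin n) ℂ) {s : Fin n → ℝ} (hs : ∀ i, 0 ≤ s i) (r : ℝ) :
    matrixAbsPow (U * realDiagonal s * V) r = star V * realDiagonal (fun i => s i ^ r) * V := by
  have hV1 := Matrix.mem_unitaryGroup_iff.1 hV
  have hU1 := Matrix.mem_unitaryGroup_iff'.1 hU
  let φ : (Fin n → ℂ) →⋆ₐ[ℝ] Matrix (Fin n) (Fin n) ℂ :=
    { toFun := fun d => star V * Matrix.diagonal d * V
      map_one' := by
        simp [Matrix.mem_unitaryGroup_iff'.1 hV]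
      map_mul' := fun c d => by
        have hcd : Matrix.diagonal (c * d) = Matrix.diagonal c * Matrix.diagonal d :=
          (Matrix.diagonal_mul_diagonal c d).symm
        rw [hcd]
        calc star V * (Matrix.diagonal c * Matrix.diagonal d) * V
            = star V * Matrix.diagonal c * 1 * Matrix.diagonal d * V := by
              simp only [Matrix.mul_assoc, Matrix.one_mul]
          _ = _ := by rw [← hV1]; simp only [Matrix.mul_assoc]
      map_zero' := by simp
      map_add' := fun c d => by
        rw [← Matrix.add_mul, ← Matrix.mul_add, Matrix.diagonal_add]
        rfl
      commutes' := fun c => by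
        have : Matrix.diagonal (algebraMap ℝ (Fin n → ℂ) c) = algebraMap ℝ _ c := by
          rw [Matrix.algebraMap_eq_diagonal]
        rw [this, Algebra.algebraMap_eq_smul_one, Matrix.mul_smul, Matrix.smul_mul, Matrix.mul_one,
          Matrix.mem_unitaryGroup_iff'.1 hV]
      map_star' := fun c => by
        simp [star_mul, Matrix.star_eq_conjTranspose, Matrix.diagonal_conjTranspose,
          Matrix.mul_assoc] }
  have hφ : ∀ d : Fin n → ℝ, φ (fun i => (d i : ℂ)) = star V * realDiagonal d * V := fun d => rfl
  have hφ0 : ∀ d : Fin n → ℝ, (∀ i, 0 ≤ d i) → 0 ≤ φ fun i => (d i : ℂ) := by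
    intro d hd
    have h1 : φ (fun i => (d i : ℂ)) =
        star (φ fun i => ((√(d i) : ℝ) : ℂ)) * φ fun i => ((√(d i) : ℝ) : ℂ) := by
      rw [← map_star, ← map_mul]
      congr 1
      ext i
      simp [← Complex.ofReal_mul, Real.mul_self_sqrt (hd i)]
    rw [h1]
    exact star_mul_self_nonneg _
  have habs : CFC.abs (U * realDiagonal s * V) = φ fun i => (s i : ℂ) := by
    refine CFC.sqrt_unique ?_ (hφ0 s hs)
    rw [hφ, star_mul, star_mul, realDiagonal_star]
    calc star V * realDiagonal s * V * (star V * realDiagonal s * V)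
        = star V * realDiagonal s * (V * star V) * realDiagonal s * V := by
          simp only [Matrix.mul_assoc]
      _ = star V * realDiagonal s * (star U * U) * realDiagonal s * V := by rw [hV1, hU1]
      _ = _ := by simp only [Matrix.mul_assoc]
  rw [matrixAbsPow, habs, ← hφ]
  have h1 := CFC.rpow_eq_cfc_real (a := φ fun i => (s i : ℂ)) (y := r) (hφ0 s hs)
  refine h1.trans ?_
  have hspec : spectrum ℝ (φ fun i => (s i : ℂ)) ⊆ Set.range s := by
    refine (AlgHom.spectrum_apply_subset φ _).trans ?_
    rw [Pi.spectrum_eq]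
    refine Set.iUnion_subset fun i => ?_
    have h2 : spectrum ℝ ((s i : ℝ) : ℂ) = {s i} := spectrum.scalar_eq (A := ℂ) (s i)
    rw [h2]
    simp
  -- The spectrum lies in the finite set of values of `s`, so the power agrees there with an
  -- interpolating polynomial, and polynomials commute with `φ`.
  set p : Polynomial ℝ := Lagrange.interpolate (Finset.univ.image s) id fun x => x ^ r with hp
  have hps : ∀ i, p.eval (s i) = s i ^ r := fun i =>
    Lagrange.eval_interpolate_at_node (v := id) (fun x : ℝ => x ^ r) (Set.injOn_id _)
      (Finset.mem_image_of_mem s (Finset.mem_univ i))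
  rw [cfc_congr (g := fun x => p.eval x) (fun x hx => by
    obtain ⟨i, rfl⟩ := hspec hx
    exact (hps i).symm), cfc_polynomial p _ (hφ0 s hs).isSelfAdjoint]
  change Polynomial.aeval (φ.toAlgHom fun i => (s i : ℂ)) p = _
  rw [Polynomial.aeval_algHom_apply]
  have haeval : Polynomial.aeval (fun i => (s i : ℂ)) p = fun i => ((s i ^ r : ℝ) : ℂ) := by
    rw [Polynomial.aeval_pi_apply]
    ext i
    change Polynomial.aeval (algebraMap ℝ ℂ (s i)) p = _
    rw [Polynomial.aeval_algebraMap_apply, Polynomial.coe_aeval_eq_eval, hps]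
    rfl
  rw [haeval]
  rfl

end Decomposition

/-! ### Determinant inequalities and Horn's inequality -/

section Determinant

open Matrix

lemma Matrix.PosSemidef.one_le_det_one_add {m : Type*} [Fintype m] [DecidableEq m]
    {P : Matrix m m ℂ} (hP : P.PosSemidef) : 1 ≤ (1 + P).det := by
  have h1 := hP.isHermitian.spectral_theorem
  rw [Unitary.conjStarAlgAut_apply] at h1
  set W : Matrix m m ℂ := hP.isHermitian.eigenvectorUnitary.1 with hW
  have hWu : W * star W = 1 :=
    Matrix.mem_unitaryGroup_iff.1 hP.isHermitian.eigenvectorUnitary.2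
  have h2 : 1 + P = W * (1 + diagonal (RCLike.ofReal ∘ hP.isHermitian.eigenvalues)) * star W := by
    rw [Matrix.mul_add, Matrix.add_mul, Matrix.mul_one, hWu]
    exact congrArg _ h1
  rw [h2, det_mul_right_comm, hWu, Matrix.one_mul, ← diagonal_one, diagonal_add, det_diagonal]
  have h3 : ∏ i, ((1 : ℂ) + (RCLike.ofReal ∘ hP.isHermitian.eigenvalues) i) =
      ((∏ i, (1 + hP.isHermitian.eigenvalues i) : ℝ) : ℂ) := by
    simp
  rw [h3]
  have h4 : (1 : ℝ) ≤ ∏ i, (1 + hP.isHermitian.eigenvalues i) :=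
    Finset.one_le_prod fun i => by simpa using hP.eigenvalues_nonneg i
  exact_mod_cast h4

open scoped MatrixOrder in
/-- The determinant is monotone on positive definite matrices. -/
lemma Matrix.PosDef.det_le_det_of_posSemidef_sub {m : Type*} [Fintype m] [DecidableEq m]
    {A B : Matrix m m ℂ} (hA : A.PosDef) (hB : (B - A).PosSemidef) : A.det ≤ B.det := by
  obtain ⟨C, hC⟩ := CStarAlgebra.nonneg_iff_eq_star_mul_self.mp hB.nonneg
  rw [star_eq_conjTranspose] at hC
  have hAu : IsUnit A.det := (Matrix.isUnit_iff_isUnit_det _).1 hA.isUnit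
  have h1 : B = A + Cᴴ * C := by rw [← hC]; abel
  rw [h1, det_add_mul _ _ hAu]
  -- The matrix determinant lemma leaves $\det B=\det A\cdot\det(1+CA^{-1}C^*)$.
  have h2 : 1 ≤ (1 + C * A⁻¹ * Cᴴ).det :=
    (hA.inv.posSemidef.mul_mul_conjTranspose_same C).one_le_det_one_add
  exact le_mul_of_one_le_right hA.det_pos.le h2

/-- A diagonal matrix with nonnegative entries on the first coordinates, factored through them. -/
lemma exists_realDiagonal_factor {n k : ℕ} (hk : k ≤ n) (d : Fin n → ℝ)
    (hd : ∀ j : Fin k, 0 ≤ d (Fin.castLE hk j)) :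
    ∃ E : Matrix (Fin k) (Fin n) ℂ, E * Eᴴ = realDiagonal (fun j => d (Fin.castLE hk j)) ∧
      Eᴴ * E = realDiagonal fun i => if i.1 < k then d i else 0 := by
  set r : Fin k → ℝ := fun j => √(d (Fin.castLE hk j)) with hr
  have hr2 : ∀ j, r j * r j = d (Fin.castLE hk j) := fun j => Real.mul_self_sqrt (hd j)
  refine ⟨Matrix.of fun j i => if Fin.castLE hk j = i then (r j : ℂ) else 0, ?_, ?_⟩
  · ext j j'
    simp only [mul_apply, conjTranspose_apply, of_apply, realDiagonal, diagonal_apply]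
    by_cases hjj : j = j'
    · subst hjj
      simp [← hr2]
    · have : Fin.castLE hk j' ≠ Fin.castLE hk j := fun h =>
        hjj (Fin.castLE_injective hk h).symm
      simp [hjj, this]
  · ext i i'
    simp only [mul_apply, conjTranspose_apply, of_apply, realDiagonal, diagonal_apply]
    by_cases hii : i = i'
    · subst hii
      by_cases hi : i.1 < k
      · have h1 : ∀ j : Fin k, Fin.castLE hk j = i ↔ j = ⟨i, hi⟩ := fun j => by
          simp [Fin.ext_iff]
        have h2 : r ⟨i, hi⟩ * r ⟨i, hi⟩ = d i := hr2 ⟨i, hi⟩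
        simp only [h1, if_pos hi, if_true]
        rw [Finset.sum_eq_single ⟨i.1, hi⟩ (fun b _ hb => by simp [hb]) (by simp), ← h2]
        simp
      · have h1 : ∀ j : Fin k, Fin.castLE hk j ≠ i := fun j h => by
          apply hi
          rw [← h]
          exact j.2
        simp [h1, hi]
    · have h1 : ∀ j : Fin k, Fin.castLE hk j = i → Fin.castLE hk j ≠ i' := fun j h h' =>
        hii (h.symm.trans h')
      rw [if_neg hii]
      refine Finset.sum_eq_zero fun j _ => ?_
      by_cases h : Fin.castLE hk j = i
      · simp [h1 j h]
      · simp [h]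

/-- After factoring out $\det(B^*B)$, the other factor is $\det(1+EQE^*)$ with $Q=B(B^*B)^{-1}B^*$
the orthogonal projection onto the range of $B$; now $Q\le 1$. -/
lemma det_gram_add_gram_le {n k m : ℕ} (B : Matrix (Fin n) (Fin k) ℂ)
    (hB : Function.Injective B.mulVec) (E : Matrix (Fin m) (Fin n) ℂ) :
    (Bᴴ * B + (E * B)ᴴ * (E * B)).det ≤ (Bᴴ * B).det * (1 + E * Eᴴ).det := by
  have hG : (Bᴴ * B).PosDef := PosDef.conjTranspose_mul_self B hB
  have hGu : IsUnit (Bᴴ * B).det := (Matrix.isUnit_iff_isUnit_det _).1 hG.isUnit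
  rw [det_add_mul _ _ hGu]
  refine mul_le_mul_of_nonneg_left ?_ hG.det_pos.le
  have hQs : (B * (Bᴴ * B)⁻¹ * Bᴴ)ᴴ = B * (Bᴴ * B)⁻¹ * Bᴴ := by
    rw [conjTranspose_mul, conjTranspose_mul, conjTranspose_conjTranspose,
      conjTranspose_nonsing_inv, conjTranspose_mul, conjTranspose_conjTranspose, Matrix.mul_assoc]
  have hQQ : B * (Bᴴ * B)⁻¹ * Bᴴ * (B * (Bᴴ * B)⁻¹ * Bᴴ) = B * (Bᴴ * B)⁻¹ * Bᴴ := by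
    calc B * (Bᴴ * B)⁻¹ * Bᴴ * (B * (Bᴴ * B)⁻¹ * Bᴴ)
        = B * ((Bᴴ * B)⁻¹ * (Bᴴ * B)) * (Bᴴ * B)⁻¹ * Bᴴ := by simp only [Matrix.mul_assoc]
      _ = B * (Bᴴ * B)⁻¹ * Bᴴ := by rw [nonsing_inv_mul _ hGu, Matrix.mul_one]
  have hQ1 : (1 - B * (Bᴴ * B)⁻¹ * Bᴴ).PosSemidef := by
    have h1 : 1 - B * (Bᴴ * B)⁻¹ * Bᴴ =
        (1 - B * (Bᴴ * B)⁻¹ * Bᴴ)ᴴ * (1 - B * (Bᴴ * B)⁻¹ * Bᴴ) := by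
      rw [conjTranspose_sub, conjTranspose_one, hQs, Matrix.mul_sub, Matrix.mul_one,
        Matrix.sub_mul, Matrix.one_mul, hQQ, sub_self, sub_zero]
    rw [h1]
    exact posSemidef_conjTranspose_mul_self _
  refine PosDef.det_le_det_of_posSemidef_sub
    (PosDef.one.add_posSemidef (hG.inv.posSemidef.mul_mul_conjTranspose_same (E * B))) ?_
  have h2 : 1 + E * Eᴴ - (1 + E * B * (Bᴴ * B)⁻¹ * (E * B)ᴴ) =
      E * (1 - B * (Bᴴ * B)⁻¹ * Bᴴ) * Eᴴ := by
    rw [conjTranspose_mul, Matrix.mul_sub, Matrix.sub_mul, Matrix.mul_one, add_sub_add_left_eq_sub]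
    simp only [Matrix.mul_assoc]
  rw [h2]
  exact hQ1.mul_mul_conjTranspose_same E

/-- The determinant of a compression of a positive diagonal matrix is bounded by the product of its
largest entries. -/
lemma det_conjTranspose_mul_realDiagonal_mul_le {n k : ℕ} (hk : k ≤ n) (l : Fin n → ℝ)
    (hl : Antitone l) (hl0 : ∀ i, 0 < l i) (B : Matrix (Fin n) (Fin k) ℂ)
    (hB : Function.Injective B.mulVec) :
    (Bᴴ * realDiagonal l * B).det ≤ (Bᴴ * B).det * ((∏ j : Fin k, l (Fin.castLE hk j) : ℝ) : ℂ) := by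
  rcases k with _ | m
  · simp
  -- The threshold `c` is the `(m+1)`-st largest entry. With `E` below, `c • (1 + Eᴴ * E)` equals
  -- `realDiagonal l` on the first `m + 1` coordinates and is `c`, hence at least as large, on the
  -- rest.
  obtain ⟨c, hc0, hc1, hc2⟩ : ∃ c : ℝ, 0 < c ∧ (∀ j : Fin (m + 1), c ≤ l (Fin.castLE hk j)) ∧
      ∀ i : Fin n, ¬ i.1 < m + 1 → l i ≤ c := by
    refine ⟨l (Fin.castLE hk (Fin.last m)), hl0 _, fun j => hl ?_, fun i hi => hl ?_⟩
    · exact (Fin.castLE_le_castLE_iff hk).2 (Fin.le_last j)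
    · rw [Fin.le_def, Fin.val_castLE, Fin.val_last]
      omega
  have hc' : (c : ℂ) ≠ 0 := by exact_mod_cast hc0.ne'
  obtain ⟨E, hEE, hEdiag⟩ := exists_realDiagonal_factor hk (fun i => l i / c - 1)
    fun j => sub_nonneg.2 ((one_le_div hc0).2 (hc1 j))
  have hpos : (Bᴴ * realDiagonal l * B).PosDef :=
    PosDef.conjTranspose_mul_mul_same (PosDef.diagonal fun i => by exact_mod_cast hl0 i) hB
  have hle1 : (Bᴴ * realDiagonal l * B).det ≤
      ((c : ℂ) • (Bᴴ * B + (E * B)ᴴ * (E * B))).det := by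
    refine hpos.det_le_det_of_posSemidef_sub ?_
    have h2 : (c : ℂ) • (1 + Eᴴ * E) - realDiagonal l =
        realDiagonal (fun i => if i.1 < m + 1 then 0 else c - l i) := by
      rw [hEdiag, ← realDiagonal_one, realDiagonal_add, ← realDiagonal_smul, realDiagonal_sub]
      congr 1
      funext i
      simp only [Pi.sub_apply, Pi.smul_apply, Pi.add_apply, smul_eq_mul]
      split_ifs
      · field_simp
        ring
      · ring
    have h1 : (c : ℂ) • (Bᴴ * B + (E * B)ᴴ * (E * B)) - Bᴴ * realDiagonal l * B =
        Bᴴ * realDiagonal (fun i => if i.1 < m + 1 then 0 else c - l i) * B := by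
      rw [← h2, conjTranspose_mul]
      simp only [Matrix.mul_sub, Matrix.sub_mul, Matrix.mul_smul, Matrix.smul_mul, Matrix.mul_add,
        Matrix.add_mul, Matrix.mul_one, Matrix.mul_assoc]
    rw [h1]
    refine PosSemidef.conjTranspose_mul_mul_same (PosSemidef.diagonal fun i => ?_) B
    have h3 : (0 : ℝ) ≤ if i.1 < m + 1 then 0 else c - l i := by
      split_ifs with hi
      · exact le_rfl
      · exact sub_nonneg.2 (hc2 i hi)
    exact Complex.zero_le_real.2 h3
  refine hle1.trans ?_
  have h4 : (1 + E * Eᴴ).det * (c : ℂ) ^ (m + 1) =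
      ((∏ j : Fin (m + 1), l (Fin.castLE hk j) : ℝ) : ℂ) := by
    rw [hEE, ← realDiagonal_one, realDiagonal_add, realDiagonal, det_diagonal]
    simp [Finset.prod_div_distrib, hc']
  have h5 : (0 : ℂ) ≤ (c : ℂ) ^ (m + 1) := by
    rw [← Complex.ofReal_pow]
    exact Complex.zero_le_real.2 (pow_nonneg hc0.le _)
  rw [← h4, det_smul, Fintype.card_fin, mul_comm, ← mul_assoc]
  exact mul_le_mul_of_nonneg_right (det_gram_add_gram_le B hB E) h5

/-- **Horn's inequality**: the singular values of a product of invertible matrices are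
log-majorized by the products of the singular values. -/
lemma prod_singular_values_mul_le {n k : ℕ} (hk : k ≤ n)
    {U₁ V₁ U₂ V₂ U₃ V₃ : Matrix (Fin n) (Fin n) ℂ}
    (hU₁ : U₁ ∈ unitaryGroup (Fin n) ℂ) (hV₁ : V₁ ∈ unitaryGroup (Fin n) ℂ)
    (hU₂ : U₂ ∈ unitaryGroup (Fin n) ℂ) (hV₂ : V₂ ∈ unitaryGroup (Fin n) ℂ)
    (hU₃ : U₃ ∈ unitaryGroup (Fin n) ℂ) (hV₃ : V₃ ∈ unitaryGroup (Fin n) ℂ)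
    {s t r : Fin n → ℝ} (hs : Antitone s) (hs0 : ∀ i, 0 < s i) (ht : Antitone t)
    (ht0 : ∀ i, 0 < t i)
    (h : U₁ * realDiagonal s * V₁ * (U₂ * realDiagonal t * V₂) = U₃ * realDiagonal r * V₃) :
    ∏ j : Fin k, r (Fin.castLE hk j) ≤
      ∏ j : Fin k, (s (Fin.castLE hk j) * t (Fin.castLE hk j)) := by
  have hgram : ∀ {U V : Matrix (Fin n) (Fin n) ℂ}, U ∈ unitaryGroup (Fin n) ℂ → ∀ (d : Fin n → ℝ)
      (B : Matrix (Fin n) (Fin k) ℂ), (U * realDiagonal d * V * B)ᴴ * (U * realDiagonal d * V * B) =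
        (V * B)ᴴ * realDiagonal (fun i => d i * d i) * (V * B) := by
    intro U V hU d B
    have h1 : Uᴴ * U = 1 := mem_unitaryGroup_iff'.1 hU
    have h2 : (realDiagonal d)ᴴ = realDiagonal d := realDiagonal_star d
    rw [← realDiagonal_mul]
    simp only [conjTranspose_mul, h2, Matrix.mul_assoc]
    rw [← Matrix.mul_assoc Uᴴ U, h1, Matrix.one_mul]
  have hanti : ∀ {d : Fin n → ℝ}, Antitone d → (∀ i, 0 < d i) → Antitone fun i => d i * d i :=
    fun hd hd0 i j hij => mul_le_mul (hd hij) (hd hij) (hd0 _).le (hd0 _).le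
  have hinj : ∀ {M : Matrix (Fin n) (Fin n) ℂ}, IsUnit M → ∀ {B : Matrix (Fin n) (Fin k) ℂ},
      Function.Injective B.mulVec → Function.Injective (M * B).mulVec := by
    intro M hM B hB x y hxy
    rw [← mulVec_mulVec, ← mulVec_mulVec] at hxy
    exact hB (mulVec_injective_of_isUnit hM hxy)
  have hunit : ∀ {V : Matrix (Fin n) (Fin n) ℂ}, V ∈ unitaryGroup (Fin n) ℂ → IsUnit V :=
    fun hV => IsUnit.of_mul_eq_one _ (mem_unitaryGroup_iff.1 hV)
  set E : Matrix (Fin n) (Fin k) ℂ := (1 : Matrix (Fin n) (Fin n) ℂ).submatrix id (Fin.castLE hk)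
    with hE
  have hEd : ∀ d : Fin n → ℝ, Eᴴ * realDiagonal d * E = realDiagonal fun j => d (Fin.castLE hk j) := by
    intro d
    have h1 : realDiagonal d * E = (realDiagonal d).submatrix id (Fin.castLE hk) := by
      ext i j
      simp [hE, realDiagonal, diagonal_apply, one_apply]
    rw [Matrix.mul_assoc, h1]
    ext i j
    by_cases hij : i = j <;>
      simp [hE, realDiagonal, diagonal_apply, mul_apply, one_apply, hij]
  have hEE : Eᴴ * E = 1 := by
    have := hEd fun _ => 1
    rwa [realDiagonal_one, Matrix.mul_one, realDiagonal_one] at this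
  have hEinj : Function.Injective E.mulVec := by
    intro x y hxy
    have := congrArg (Eᴴ.mulVec) hxy
    simpa [mulVec_mulVec, hEE] using this
  -- The columns of `B` are the first `k` right singular vectors of the product, so its Gram
  -- determinant on them is the product of the `r²`. The compression bound is applied twice, peeling
  -- off the left factor and then the right.
  set B := V₃ᴴ * E with hB
  have hBinj : Function.Injective B.mulVec := hinj (hunit (Unitary.star_mem hV₃)) hEinj
  set Y := U₂ * realDiagonal t * V₂ with hY
  have hYu : IsUnit Y :=
    ((hunit hU₂).mul (isUnit_realDiagonal fun i => (ht0 i).ne')).mul (hunit hV₂)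
  have hV₃B : V₃ * B = E := by
    rw [hB, ← Matrix.mul_assoc, show V₃ * V₃ᴴ = 1 from mem_unitaryGroup_iff.1 hV₃, Matrix.one_mul]
  have hBB : Bᴴ * B = 1 := by
    rw [hB, conjTranspose_mul, conjTranspose_conjTranspose, Matrix.mul_assoc, ← hB, hV₃B, hEE]
  have hunitary : ∀ {V : Matrix (Fin n) (Fin n) ℂ}, V ∈ unitaryGroup (Fin n) ℂ →
      ∀ C : Matrix (Fin n) (Fin k) ℂ, (V * C)ᴴ * (V * C) = Cᴴ * C := by
    intro V hV C
    rw [conjTranspose_mul, Matrix.mul_assoc, ← Matrix.mul_assoc Vᴴ,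
      show Vᴴ * V = 1 from mem_unitaryGroup_iff'.1 hV, Matrix.one_mul]
  have h1 : ((U₃ * realDiagonal r * V₃ * B)ᴴ * (U₃ * realDiagonal r * V₃ * B)).det =
      ((∏ j : Fin k, (r (Fin.castLE hk j) * r (Fin.castLE hk j)) : ℝ) : ℂ) := by
    rw [hgram hU₃, hV₃B, hEd, realDiagonal, det_diagonal]
    simp
  have h2 := det_conjTranspose_mul_realDiagonal_mul_le hk _ (hanti hs hs0)
    (fun i => mul_pos (hs0 i) (hs0 i)) (V₁ * (Y * B)) (hinj (hunit hV₁) (hinj hYu hBinj))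
  have h3 := det_conjTranspose_mul_realDiagonal_mul_le hk _ (hanti ht ht0)
    (fun i => mul_pos (ht0 i) (ht0 i)) (V₂ * B) (hinj (hunit hV₂) hBinj)
  rw [← hgram hU₁, hunitary hV₁, ← Matrix.mul_assoc (U₁ * realDiagonal s * V₁), h, h1] at h2
  rw [← hgram hU₂, hunitary hV₂, hBB, det_one, one_mul] at h3
  have h4 : ((∏ j : Fin k, (r (Fin.castLE hk j) * r (Fin.castLE hk j)) : ℝ) : ℂ) ≤
      ((∏ j : Fin k, (t (Fin.castLE hk j) * t (Fin.castLE hk j)) : ℝ) : ℂ) *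
        ((∏ j : Fin k, (s (Fin.castLE hk j) * s (Fin.castLE hk j)) : ℝ) : ℂ) := by
    refine h2.trans (mul_le_mul_of_nonneg_right h3 ?_)
    have : (0 : ℝ) ≤ ∏ j : Fin k, (s (Fin.castLE hk j) * s (Fin.castLE hk j)) :=
      Finset.prod_nonneg fun j _ => mul_self_nonneg _
    exact_mod_cast this
  have h5 : ∏ j : Fin k, (r (Fin.castLE hk j) * r (Fin.castLE hk j)) ≤
      (∏ j : Fin k, (t (Fin.castLE hk j) * t (Fin.castLE hk j))) *
        ∏ j : Fin k, (s (Fin.castLE hk j) * s (Fin.castLE hk j)) := by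
    exact_mod_cast h4
  simp only [Finset.prod_mul_distrib] at h5 ⊢
  refine abs_le_of_sq_le_sq' ?_ ?_ |>.2
  · nlinarith
  · exact mul_nonneg (Finset.prod_nonneg fun j _ => (hs0 _).le)
      (Finset.prod_nonneg fun j _ => (ht0 _).le)

end Determinant

/-! ### Monotonicity of powers and products -/

section Auxiliary

variable {n : ℕ}

lemma isUnit_of_mem_unitaryGroup {V : Matrix (Fin n) (Fin n) ℂ}
    (hV : V ∈ Matrix.unitaryGroup (Fin n) ℂ) : IsUnit V :=
  IsUnit.of_mul_eq_one _ (Matrix.mem_unitaryGroup_iff.1 hV)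

lemma antitone_rpow {s : Fin n → ℝ} (hs : Antitone s) (hs0 : ∀ i, 0 ≤ s i) {r : ℝ} (hr : 0 ≤ r) :
    Antitone fun i => s i ^ r :=
  fun _ j hij => Real.rpow_le_rpow (hs0 j) (hs hij) hr

lemma antitone_mul {s t : Fin n → ℝ} (hs : Antitone s) (hs0 : ∀ i, 0 ≤ s i) (ht : Antitone t)
    (ht0 : ∀ i, 0 ≤ t i) : Antitone fun i => s i * t i :=
  fun i j hij => mul_le_mul (hs hij) (ht hij) (ht0 j) (hs0 i)

end Auxiliary

/-! ### Continuity of the power of the absolute value -/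

section Continuity

variable {n : ℕ}

open scoped MatrixOrder Matrix.Norms.L2Operator in
lemma continuous_matrixAbsPow {r : ℝ} (hr : 0 < r) :
    Continuous fun A : Matrix (Fin n) (Fin n) ℂ => matrixAbsPow A r := by
  lift r to NNReal using hr.le
  have hr' : 0 < r := by exact_mod_cast hr
  have h1 : ∀ A : Matrix (Fin n) (Fin n) ℂ, matrixAbsPow A r = CFC.abs A ^ r := fun A =>
    (CFC.nnrpow_eq_rpow hr').symm
  simp only [h1]
  exact (CFC.continuousOn_nnrpow r).comp_continuous CFC.continuous_abs fun A => CFC.abs_nonneg A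

lemma continuous_realDiagonal : Continuous (realDiagonal : (Fin n → ℝ) → _) := by
  unfold realDiagonal
  fun_prop

end Continuity

/-! ### Hölder's inequality and optimal factorizations -/

namespace UnitarilyInvariantNorm

open Matrix Filter Topology

variable {n : ℕ} (N : UnitarilyInvariantNorm n)

lemma matrixAbsPow_eq {U V : Matrix (Fin n) (Fin n) ℂ} (hU : U ∈ unitaryGroup (Fin n) ℂ)
    (hV : V ∈ unitaryGroup (Fin n) ℂ) {s : Fin n → ℝ} (hs : ∀ i, 0 ≤ s i) (r : ℝ) :
    N (matrixAbsPow (U * realDiagonal s * V) r) = N (realDiagonal fun i => s i ^ r) := by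
  rw [_root_.matrixAbsPow_eq hU hV hs, N.conj_apply hV]

/-- Horn's inequality, raised to the power `r`, feeds Ky Fan dominance; positivity is needed for the
logarithms. -/
lemma matrixAbsPow_mul_le_of_pos {U₁ V₁ U₂ V₂ : Matrix (Fin n) (Fin n) ℂ}
    (hU₁ : U₁ ∈ unitaryGroup (Fin n) ℂ) (hV₁ : V₁ ∈ unitaryGroup (Fin n) ℂ)
    (hU₂ : U₂ ∈ unitaryGroup (Fin n) ℂ) (hV₂ : V₂ ∈ unitaryGroup (Fin n) ℂ)
    {s t : Fin n → ℝ} (hs : Antitone s) (hs0 : ∀ i, 0 < s i) (ht : Antitone t)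
    (ht0 : ∀ i, 0 < t i) {r : ℝ} (hr : 0 < r) :
    N (matrixAbsPow (U₁ * realDiagonal s * V₁ * (U₂ * realDiagonal t * V₂)) r) ≤
      N (realDiagonal fun i => (s i * t i) ^ r) := by
  obtain ⟨U₃, hU₃, V₃, hV₃, x, hx, hx0, h⟩ := exists_singular_value_decomposition
    (U₁ * realDiagonal s * V₁ * (U₂ * realDiagonal t * V₂))
  have hXu : IsUnit (U₁ * realDiagonal s * V₁ * (U₂ * realDiagonal t * V₂)) :=
    (((isUnit_of_mem_unitaryGroup hU₁).mul (isUnit_realDiagonal fun i => (hs0 i).ne')).mul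
      (isUnit_of_mem_unitaryGroup hV₁)).mul
    (((isUnit_of_mem_unitaryGroup hU₂).mul (isUnit_realDiagonal fun i => (ht0 i).ne')).mul
      (isUnit_of_mem_unitaryGroup hV₂))
  have hx1 : ∀ i, 0 < x i := by
    have h1 : IsUnit (realDiagonal x) := by
      have h2 : realDiagonal x = star U₃ *
          (U₁ * realDiagonal s * V₁ * (U₂ * realDiagonal t * V₂)) * star V₃ := by
        rw [h, Matrix.mul_assoc, Matrix.mul_assoc (U₃ * _), mem_unitaryGroup_iff.1 hV₃,
          Matrix.mul_one, ← Matrix.mul_assoc, mem_unitaryGroup_iff'.1 hU₃, Matrix.one_mul]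
      rw [h2]
      exact ((isUnit_of_mem_unitaryGroup (Unitary.star_mem hU₃)).mul hXu).mul
        (isUnit_of_mem_unitaryGroup (Unitary.star_mem hV₃))
    exact fun i => lt_of_le_of_ne (hx0 i) (ne_zero_of_isUnit_realDiagonal h1 i).symm
  rw [h, N.matrixAbsPow_eq hU₃ hV₃ hx0]
  have hxr : ∀ i, 0 < x i ^ r := fun i => Real.rpow_pos_of_pos (hx1 i) r
  refine N.realDiagonal_le_of_forall_weights (antitone_rpow hx hx0 hr.le) (fun i => (hxr i).le)
    fun w hw hw0 => sum_mul_le_sum_mul_of_prod_le w _ _ hw hw0 (antitone_rpow hx hx0 hr.le) hxr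
      (fun i => Real.rpow_pos_of_pos (mul_pos (hs0 i) (ht0 i)) r) fun k hk => ?_
  rw [Real.finsetProd_rpow _ _ (fun i _ => hx0 _),
    Real.finsetProd_rpow _ _ (fun i _ => (mul_pos (hs0 _) (ht0 _)).le)]
  exact Real.rpow_le_rpow (Finset.prod_nonneg fun i _ => hx0 _)
    (prod_singular_values_mul_le hk hU₁ hV₁ hU₂ hV₂ hU₃ hV₃ hs hs0 ht ht0 h) hr.le

/-- The power of the absolute value of a product is dominated by the powers of the products of the
singular values. -/
lemma matrixAbsPow_mul_le {U₁ V₁ U₂ V₂ : Matrix (Fin n) (Fin n) ℂ}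
    (hU₁ : U₁ ∈ unitaryGroup (Fin n) ℂ) (hV₁ : V₁ ∈ unitaryGroup (Fin n) ℂ)
    (hU₂ : U₂ ∈ unitaryGroup (Fin n) ℂ) (hV₂ : V₂ ∈ unitaryGroup (Fin n) ℂ)
    {s t : Fin n → ℝ} (hs : Antitone s) (hs0 : ∀ i, 0 ≤ s i) (ht : Antitone t)
    (ht0 : ∀ i, 0 ≤ t i) {r : ℝ} (hr : 0 < r) :
    N (matrixAbsPow (U₁ * realDiagonal s * V₁ * (U₂ * realDiagonal t * V₂)) r) ≤
      N (realDiagonal fun i => (s i * t i) ^ r) := by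
  -- Both sides are continuous in a shift `ε` of the singular values; let `ε` decrease to `0`.
  have hshift : ∀ d : Fin n → ℝ, Continuous fun ε : ℝ => fun i => d i + ε := fun d => by fun_prop
  have h1 : Continuous fun ε : ℝ =>
      N (matrixAbsPow (U₁ * realDiagonal (fun i => s i + ε) * V₁ *
        (U₂ * realDiagonal (fun i => t i + ε) * V₂)) r) := by
    refine N.continuous.comp ((continuous_matrixAbsPow hr).comp ?_)
    have hs' := continuous_realDiagonal.comp (hshift s)
    have ht' := continuous_realDiagonal.comp (hshift t)
    exact ((continuous_const.matrix_mul hs').matrix_mul continuous_const).matrix_mul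
      ((continuous_const.matrix_mul ht').matrix_mul continuous_const)
  have h2 : Continuous fun ε : ℝ => N (realDiagonal fun i => ((s i + ε) * (t i + ε)) ^ r) := by
    refine N.continuous.comp (continuous_realDiagonal.comp ?_)
    refine continuous_pi fun i => ?_
    exact Continuous.rpow_const (by fun_prop) fun _ => Or.inr hr.le
  have h3 := (h1.tendsto 0).mono_left (nhdsWithin_le_nhds (s := Set.Ioi 0))
  have h4 := (h2.tendsto 0).mono_left (nhdsWithin_le_nhds (s := Set.Ioi 0))
  simp only [add_zero] at h3 h4
  refine le_of_tendsto_of_tendsto h3 h4 ?_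
  filter_upwards [self_mem_nhdsWithin] with ε hε
  exact N.matrixAbsPow_mul_le_of_pos hU₁ hV₁ hU₂ hV₂ (fun i j hij => by simpa using hs hij)
    (fun i => add_pos_of_nonneg_of_pos (hs0 i) hε) (fun i j hij => by simpa using ht hij)
    (fun i => add_pos_of_nonneg_of_pos (ht0 i) hε) hr

/-- The products `κ i * t i` do not exceed `t i`. This lets `X` be replaced by its invertible
perturbation. -/
lemma matrixAbsPow_contraction_mul_le {U V : Matrix (Fin n) (Fin n) ℂ}
    (hU : U ∈ unitaryGroup (Fin n) ℂ) (hV : V ∈ unitaryGroup (Fin n) ℂ) {κ : Fin n → ℝ}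
    (hκ : Antitone κ) (hκ0 : ∀ i, 0 ≤ κ i) (hκ1 : ∀ i, κ i ≤ 1) (A : Matrix (Fin n) (Fin n) ℂ)
    {r : ℝ} (hr : 0 < r) :
    N (matrixAbsPow (U * realDiagonal κ * V * A) r) ≤ N (matrixAbsPow A r) := by
  obtain ⟨U₂, hU₂, V₂, hV₂, t, ht, ht0, rfl⟩ := exists_singular_value_decomposition A
  rw [N.matrixAbsPow_eq hU₂ hV₂ ht0]
  refine (N.matrixAbsPow_mul_le hU hV hU₂ hV₂ hκ hκ0 ht ht0 hr).trans ?_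
  have h0 : ∀ i, 0 ≤ κ i * t i := fun i => mul_nonneg (hκ0 i) (ht0 i)
  exact N.realDiagonal_mono (antitone_rpow (antitone_mul hκ hκ0 ht ht0) h0 hr.le)
    (fun i => Real.rpow_nonneg (h0 i) r)
    fun i => Real.rpow_le_rpow (h0 i) (mul_le_of_le_one_left (ht0 i) (hκ1 i)) hr.le

lemma matrixAbsPow_mul_contraction_le {U V : Matrix (Fin n) (Fin n) ℂ}
    (hU : U ∈ unitaryGroup (Fin n) ℂ) (hV : V ∈ unitaryGroup (Fin n) ℂ) {κ : Fin n → ℝ}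
    (hκ : Antitone κ) (hκ0 : ∀ i, 0 ≤ κ i) (hκ1 : ∀ i, κ i ≤ 1) (A : Matrix (Fin n) (Fin n) ℂ)
    {r : ℝ} (hr : 0 < r) :
    N (matrixAbsPow (A * (U * realDiagonal κ * V)) r) ≤ N (matrixAbsPow A r) := by
  obtain ⟨U₂, hU₂, V₂, hV₂, t, ht, ht0, rfl⟩ := exists_singular_value_decomposition A
  rw [N.matrixAbsPow_eq hU₂ hV₂ ht0]
  refine (N.matrixAbsPow_mul_le hU₂ hV₂ hU hV ht ht0 hκ hκ0 hr).trans ?_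
  have h0 : ∀ i, 0 ≤ t i * κ i := fun i => mul_nonneg (ht0 i) (hκ0 i)
  exact N.realDiagonal_mono (antitone_rpow (antitone_mul ht ht0 hκ hκ0) h0 hr.le)
    (fun i => Real.rpow_nonneg (h0 i) r)
    fun i => Real.rpow_le_rpow (h0 i) (mul_le_of_le_one_right (ht0 i) (hκ1 i)) hr.le

/-- **Hölder's inequality** for a unitarily invariant norm on diagonal matrices. -/
lemma realDiagonal_mul_le {p q : ℝ} (hpq : p.HolderConjugate q) {a b : Fin n → ℝ} (ha : Antitone a)
    (ha0 : ∀ i, 0 ≤ a i) (hb : Antitone b) (hb0 : ∀ i, 0 ≤ b i) :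
    N (realDiagonal fun i => a i * b i) ≤
      N (realDiagonal fun i => a i ^ p) ^ (1 / p) * N (realDiagonal fun i => b i ^ q) ^ (1 / q) := by
  have hzero : ∀ (d : Fin n → ℝ) (r : ℝ), r ≠ 0 → (∀ i, 0 ≤ d i) →
      N (realDiagonal fun i => d i ^ r) = 0 → ∀ i, d i = 0 := by
    intro d r hr hd h i
    have h1 := congrFun (congrFun (N.eq_zero_of_map_eq_zero _ h) i) i
    simp only [realDiagonal, diagonal_apply_eq, Matrix.zero_apply, Complex.ofReal_eq_zero] at h1
    exact ((Real.rpow_eq_zero (hd i) hr).1 h1)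
  have hN0 : N (realDiagonal fun _ => 0) = 0 := by
    have h1 : realDiagonal (fun _ : Fin n => 0) = 0 := by simp [realDiagonal]
    rw [h1]
    exact map_zero N.toSeminorm
  set A := N (realDiagonal fun i => a i ^ p) with hA
  set B := N (realDiagonal fun i => b i ^ q) with hB
  have hAB0 : 0 ≤ A ^ (1 / p) * B ^ (1 / q) :=
    mul_nonneg (Real.rpow_nonneg (N.nonneg _) _) (Real.rpow_nonneg (N.nonneg _) _)
  -- If either norm vanishes, definiteness kills that vector; otherwise Young's inequality is used
  -- on `a` and `b` normalized by `A ^ (1 / p)` and `B ^ (1 / q)`.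
  rcases (N.nonneg (realDiagonal fun i => a i ^ p)).eq_or_lt with hA0 | hA0
  · have h1 := hzero a p hpq.ne_zero ha0 hA0.symm
    simpa [h1, hN0] using hAB0
  rcases (N.nonneg (realDiagonal fun i => b i ^ q)).eq_or_lt with hB0 | hB0
  · have h1 := hzero b q hpq.symm.ne_zero hb0 hB0.symm
    simpa [h1, hN0] using hAB0
  have hA1 : 0 < A ^ (1 / p) := Real.rpow_pos_of_pos hA0 _
  have hB1 : 0 < B ^ (1 / q) := Real.rpow_pos_of_pos hB0 _
  have hAp : (A ^ (1 / p)) ^ p = A := by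
    rw [← Real.rpow_mul hA0.le, one_div_mul_cancel hpq.ne_zero, Real.rpow_one]
  have hBq : (B ^ (1 / q)) ^ q = B := by
    rw [← Real.rpow_mul hB0.le, one_div_mul_cancel hpq.symm.ne_zero, Real.rpow_one]
  have hp1 : 0 ≤ 1 / p / A := by have := hpq.pos; positivity
  have hq1 : 0 ≤ 1 / q / B := by have := hpq.symm.pos; positivity
  have hyoung : ∀ i, a i * b i ≤ A ^ (1 / p) * B ^ (1 / q) *
      (1 / p / A * a i ^ p + 1 / q / B * b i ^ q) := by
    intro i
    have h1 := Real.young_inequality_of_nonneg (div_nonneg (ha0 i) hA1.le)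
      (div_nonneg (hb0 i) hB1.le) hpq
    rw [Real.div_rpow (ha0 i) hA1.le, Real.div_rpow (hb0 i) hB1.le, hAp, hBq] at h1
    calc a i * b i = A ^ (1 / p) * B ^ (1 / q) * (a i / A ^ (1 / p) * (b i / B ^ (1 / q))) := by
          field_simp
      _ ≤ A ^ (1 / p) * B ^ (1 / q) * (a i ^ p / A / p + b i ^ q / B / q) :=
          mul_le_mul_of_nonneg_left h1 hAB0
      _ = _ := by ring
  calc N (realDiagonal fun i => a i * b i)
      ≤ N (realDiagonal ((A ^ (1 / p) * B ^ (1 / q)) •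
          ((1 / p / A) • (fun i => a i ^ p) + (1 / q / B) • fun i => b i ^ q))) :=
        N.realDiagonal_mono (antitone_mul ha ha0 hb hb0) (fun i => mul_nonneg (ha0 i) (hb0 i)) hyoung
    _ = A ^ (1 / p) * B ^ (1 / q) *
          N (realDiagonal ((1 / p / A) • (fun i => a i ^ p) + (1 / q / B) • fun i => b i ^ q)) :=
        N.realDiagonal_smul hAB0 _
    _ ≤ A ^ (1 / p) * B ^ (1 / q) * (1 / p / A * A + 1 / q / B * B) := by
        refine mul_le_mul_of_nonneg_left ?_ hAB0
        rw [← realDiagonal_add]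
        refine (N.add_le _ _).trans (le_of_eq ?_)
        rw [N.realDiagonal_smul hp1, N.realDiagonal_smul hq1]
    _ = A ^ (1 / p) * B ^ (1 / q) := by
        rw [div_mul_cancel₀ _ hA0.ne', div_mul_cancel₀ _ hB0.ne', one_div, one_div,
          hpq.inv_add_inv_eq_one, mul_one]

/-- **Hölder's inequality** for unitarily invariant norms. -/
lemma matrixAbsPow_mul_le_rpow_mul_rpow {p q : ℝ} (hpq : p.HolderConjugate q) {α : ℝ} (hα : 0 < α)
    (A B : Matrix (Fin n) (Fin n) ℂ) :
    N (matrixAbsPow (A * B) α) ≤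
      N (matrixAbsPow A (α * p)) ^ (1 / p) * N (matrixAbsPow B (α * q)) ^ (1 / q) := by
  obtain ⟨U₁, hU₁, V₁, hV₁, s, hs, hs0, rfl⟩ := exists_singular_value_decomposition A
  obtain ⟨U₂, hU₂, V₂, hV₂, t, ht, ht0, rfl⟩ := exists_singular_value_decomposition B
  refine (N.matrixAbsPow_mul_le hU₁ hV₁ hU₂ hV₂ hs hs0 ht ht0 hα).trans ?_
  rw [N.matrixAbsPow_eq hU₁ hV₁ hs0, N.matrixAbsPow_eq hU₂ hV₂ ht0]
  simp only [Real.mul_rpow (hs0 _) (ht0 _), Real.rpow_mul (hs0 _), Real.rpow_mul (ht0 _)]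
  exact N.realDiagonal_mul_le hpq (antitone_rpow hs hs0 hα.le) (fun i => Real.rpow_nonneg (hs0 i) α)
    (antitone_rpow ht ht0 hα.le) (fun i => Real.rpow_nonneg (ht0 i) α)

/-- A factorization of a product of invertible matrices attaining equality in Hölder's
inequality. -/
lemma exists_matrixAbsPow_eq {p q : ℝ} (hpq : p.HolderConjugate q) (α : ℝ)
    {X Y : Matrix (Fin n) (Fin n) ℂ} (hX : IsUnit X) (hY : IsUnit Y) :
    ∃ Z : (Matrix (Fin n) (Fin n) ℂ)ˣ,
      N (matrixAbsPow (X * (Z : Matrix (Fin n) (Fin n) ℂ)) (α * p)) = N (matrixAbsPow (X * Y) α) ∧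
      N (matrixAbsPow ((Z⁻¹ : (Matrix (Fin n) (Fin n) ℂ)ˣ) * Y) (α * q)) =
        N (matrixAbsPow (X * Y) α) := by
  obtain ⟨U, hU, V, hV, r, -, hr0, h⟩ := exists_singular_value_decomposition (X * Y)
  have hUu := isUnit_of_mem_unitaryGroup hU
  have hVu := isUnit_of_mem_unitaryGroup hV
  have hr1 : ∀ i, 0 < r i := by
    have h1 : IsUnit (realDiagonal r) := by
      have h2 := hX.mul hY
      rw [h] at h2
      exact hUu.mul_left_iff.1 (hVu.mul_right_iff.1 h2)
    exact fun i => lt_of_le_of_ne (hr0 i) (ne_zero_of_isUnit_realDiagonal h1 i).symm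
  have hru : IsUnit (realDiagonal fun i => r i ^ (1 / p)) :=
    isUnit_realDiagonal fun i => (Real.rpow_pos_of_pos (hr1 i) _).ne'
  obtain ⟨x, rfl⟩ := hX
  obtain ⟨w, hw⟩ := (hUu.mul hru).mul hVu
  have hsplit : realDiagonal r =
      realDiagonal (fun i => r i ^ (1 / p)) * realDiagonal fun i => r i ^ (1 / q) := by
    rw [realDiagonal_mul]
    congr 1
    funext i
    rw [← Real.rpow_add (hr1 i), one_div, one_div, hpq.inv_add_inv_eq_one, Real.rpow_one]
  have hpow : ∀ c : ℝ, c ≠ 0 → ∀ i, (r i ^ (1 / c)) ^ (α * c) = r i ^ α := fun c hc i => by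
    rw [← Real.rpow_mul (hr0 i)]
    congr 1
    field_simp
  refine ⟨x⁻¹ * w, ?_, ?_⟩
  · rw [Units.val_mul, Units.mul_inv_cancel_left, hw, h, N.matrixAbsPow_eq hU hV hr0,
      N.matrixAbsPow_eq hU hV fun i => Real.rpow_nonneg (hr0 i) _]
    simp only [hpow p hpq.ne_zero]
  · have h1 : ((x⁻¹ * w)⁻¹ : (Matrix (Fin n) (Fin n) ℂ)ˣ) * Y =
        star V * realDiagonal (fun i => r i ^ (1 / q)) * V := by
      rw [_root_.mul_inv_rev, inv_inv, Units.val_mul, mul_assoc, Units.inv_mul_eq_iff_eq_mul, h, hw, hsplit]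
      calc U * (realDiagonal (fun i => r i ^ (1 / p)) * realDiagonal fun i => r i ^ (1 / q)) * V
          = U * realDiagonal (fun i => r i ^ (1 / p)) * 1 *
              realDiagonal (fun i => r i ^ (1 / q)) * V := by
            simp only [Matrix.mul_assoc, Matrix.one_mul]
        _ = _ := by
            rw [← mem_unitaryGroup_iff.1 hV]
            simp only [Matrix.mul_assoc]
    rw [h1, h, N.matrixAbsPow_eq hU hV hr0,
      N.matrixAbsPow_eq (Unitary.star_mem hV) hV fun i => Real.rpow_nonneg (hr0 i) _]
    simp only [hpow q hpq.symm.ne_zero]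

/-- Factorizations of a product of arbitrary matrices that almost attain equality in Hölder's
inequality. -/
lemma exists_matrixAbsPow_le {p q : ℝ} (hpq : p.HolderConjugate q) {α : ℝ} (hα : 0 < α)
    (X Y : Matrix (Fin n) (Fin n) ℂ) {c : ℝ} (hc : N (matrixAbsPow (X * Y) α) < c) :
    ∃ Z : (Matrix (Fin n) (Fin n) ℂ)ˣ,
      N (matrixAbsPow (X * (Z : Matrix (Fin n) (Fin n) ℂ)) (α * p)) ≤ c ∧
      N (matrixAbsPow ((Z⁻¹ : (Matrix (Fin n) (Fin n) ℂ)ˣ) * Y) (α * q)) ≤ c := by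
  obtain ⟨U₁, hU₁, V₁, hV₁, s, hs, hs0, rfl⟩ := exists_singular_value_decomposition X
  obtain ⟨U₂, hU₂, V₂, hV₂, t, ht, ht0, rfl⟩ := exists_singular_value_decomposition Y
  have hshift : ∀ d : Fin n → ℝ, Continuous fun ε : ℝ => fun i => d i + ε := fun d => by fun_prop
  have h1 : Continuous fun ε : ℝ =>
      N (matrixAbsPow (U₁ * realDiagonal (fun i => s i + ε) * V₁ *
        (U₂ * realDiagonal (fun i => t i + ε) * V₂)) α) := by
    refine N.continuous.comp ((continuous_matrixAbsPow hα).comp ?_)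
    have hs' := continuous_realDiagonal.comp (hshift s)
    have ht' := continuous_realDiagonal.comp (hshift t)
    exact ((continuous_const.matrix_mul hs').matrix_mul continuous_const).matrix_mul
      ((continuous_const.matrix_mul ht').matrix_mul continuous_const)
  have h2 := (h1.tendsto 0).mono_left (nhdsWithin_le_nhds (s := Set.Ioi 0))
  simp only [add_zero] at h2
  obtain ⟨ε, hεc, hε⟩ := ((h2.eventually_lt_const hc).and self_mem_nhdsWithin).exists
  have hε : 0 < ε := hε
  have hunit : ∀ {U V : Matrix (Fin n) (Fin n) ℂ}, U ∈ unitaryGroup (Fin n) ℂ →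
      V ∈ unitaryGroup (Fin n) ℂ → ∀ {d : Fin n → ℝ}, (∀ i, 0 ≤ d i) →
      IsUnit (U * realDiagonal (fun i => d i + ε) * V) := fun hU hV d hd =>
    ((isUnit_of_mem_unitaryGroup hU).mul
      (isUnit_realDiagonal fun i => (add_pos_of_nonneg_of_pos (hd i) hε).ne')).mul
      (isUnit_of_mem_unitaryGroup hV)
  have hκ : ∀ {d : Fin n → ℝ}, Antitone d → (∀ i, 0 ≤ d i) →
      Antitone fun i => d i / (d i + ε) := fun {d} hd hd0 i j hij => by
    have h3 := hd hij
    have h4 := hd0 j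
    have h5 := hd0 i
    rw [div_le_div_iff₀ (by positivity) (by positivity)]
    nlinarith
  have hκ0 : ∀ {d : Fin n → ℝ}, (∀ i, 0 ≤ d i) → ∀ i, 0 ≤ d i / (d i + ε) :=
    fun hd0 i => div_nonneg (hd0 i) (add_pos_of_nonneg_of_pos (hd0 i) hε).le
  have hκ1 : ∀ {d : Fin n → ℝ}, (∀ i, 0 ≤ d i) → ∀ i, d i / (d i + ε) ≤ 1 :=
    fun hd0 i => div_le_one_of_le₀ (le_add_of_nonneg_right hε.le)
      (add_pos_of_nonneg_of_pos (hd0 i) hε).le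
  obtain ⟨Z, hZ1, hZ2⟩ := N.exists_matrixAbsPow_eq hpq α (hunit hU₁ hV₁ hs0) (hunit hU₂ hV₂ ht0)
  have hαp : 0 < α * p := mul_pos hα hpq.pos
  have hαq : 0 < α * q := mul_pos hα hpq.symm.pos
  refine ⟨Z, le_trans ?_ (hZ1.trans_lt hεc).le, le_trans ?_ (hZ2.trans_lt hεc).le⟩
  -- The contraction with $X=KX_\varepsilon$ is $K=U_1\,\mathrm{diag}(s/(s+\varepsilon))\,U_1^*$;
  -- for $Y$ it stands on the right and is built from $V_2$.
  · refine le_trans (le_of_eq ?_) (N.matrixAbsPow_contraction_mul_le hU₁ (Unitary.star_mem hU₁)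
      (hκ hs hs0) (hκ0 hs0) (hκ1 hs0) _ hαp)
    congr 2
    have h3 : realDiagonal s =
        realDiagonal (fun i => s i / (s i + ε)) * realDiagonal fun i => s i + ε := by
      rw [realDiagonal_mul]
      congr 1
      funext i
      rw [div_mul_cancel₀ _ (add_pos_of_nonneg_of_pos (hs0 i) hε).ne']
    calc U₁ * realDiagonal s * V₁ * (Z : Matrix (Fin n) (Fin n) ℂ)
        = U₁ * realDiagonal (fun i => s i / (s i + ε)) * 1 * realDiagonal (fun i => s i + ε) *
            V₁ * Z := by
          rw [h3]
          simp only [Matrix.mul_assoc, Matrix.one_mul]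
      _ = _ := by
          rw [← mem_unitaryGroup_iff'.1 hU₁]
          simp only [Matrix.mul_assoc]
  · refine le_trans (le_of_eq ?_) (N.matrixAbsPow_mul_contraction_le (Unitary.star_mem hV₂) hV₂
      (hκ ht ht0) (hκ0 ht0) (hκ1 ht0) _ hαq)
    congr 2
    have h3 : realDiagonal t =
        (realDiagonal fun i => t i + ε) * realDiagonal (fun i => t i / (t i + ε)) := by
      rw [realDiagonal_mul]
      congr 1
      funext i
      rw [mul_div_cancel₀ _ (add_pos_of_nonneg_of_pos (ht0 i) hε).ne']
    calc ((Z⁻¹ : (Matrix (Fin n) (Fin n) ℂ)ˣ) : Matrix (Fin n) (Fin n) ℂ) *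
          (U₂ * realDiagonal t * V₂)
        = (Z⁻¹ : (Matrix (Fin n) (Fin n) ℂ)ˣ) * (U₂ * realDiagonal (fun i => t i + ε) * 1 *
            realDiagonal (fun i => t i / (t i + ε)) * V₂) := by
          rw [h3]
          simp only [Matrix.mul_assoc, Matrix.one_mul]
      _ = _ := by
          rw [← mem_unitaryGroup_iff.1 hV₂]
          simp only [Matrix.mul_assoc]

end UnitarilyInvariantNorm

/-! ### The variational formulas -/

theorem proposition2 (n : ℕ) (X Y : Matrix (Fin n) (Fin n) ℂ) (α p q : ℝ)
    (hα : 0 < α) (hp : 1 < p) (hq : q = p / (p - 1)) (N : UnitarilyInvariantNorm n) :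
    IsGLB
        (Set.range fun Z : (Matrix (Fin n) (Fin n) ℂ)ˣ =>
          N (matrixAbsPow (X * (Z : Matrix (Fin n) (Fin n) ℂ)) (α * p)) ^ (1 / p) *
            N (matrixAbsPow ((Z⁻¹ : (Matrix (Fin n) (Fin n) ℂ)ˣ) * Y) (α * q)) ^ (1 / q))
        (N (matrixAbsPow (X * Y) α)) ∧
      IsGLB
        (Set.range fun Z : (Matrix (Fin n) (Fin n) ℂ)ˣ =>
          1 / p * N (matrixAbsPow (X * (Z : Matrix (Fin n) (Fin n) ℂ)) (α * p)) +
            1 / q * N (matrixAbsPow ((Z⁻¹ : (Matrix (Fin n) (Fin n) ℂ)ˣ) * Y) (α * q)))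
        (N (matrixAbsPow (X * Y) α)) ∧
      (IsUnit X → IsUnit Y →
        IsLeast
            (Set.range fun Z : (Matrix (Fin n) (Fin n) ℂ)ˣ =>
              N (matrixAbsPow (X * (Z : Matrix (Fin n) (Fin n) ℂ)) (α * p)) ^ (1 / p) *
                N (matrixAbsPow ((Z⁻¹ : (Matrix (Fin n) (Fin n) ℂ)ˣ) * Y) (α * q)) ^ (1 / q))
            (N (matrixAbsPow (X * Y) α)) ∧
          IsLeast
            (Set.range fun Z : (Matrix (Fin n) (Fin n) ℂ)ˣ =>
              1 / p * N (matrixAbsPow (X * (Z : Matrix (Fin n) (Fin n) ℂ)) (α * p)) +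
                1 / q * N (matrixAbsPow ((Z⁻¹ : (Matrix (Fin n) (Fin n) ℂ)ˣ) * Y) (α * q)))
            (N (matrixAbsPow (X * Y) α))) := by
  have hpq : p.HolderConjugate q := by
    rw [hq]
    exact Real.HolderConjugate.conjExponent hp
  have hp0 : 0 < 1 / p := one_div_pos.2 hpq.pos
  have hq0 : 0 < 1 / q := one_div_pos.2 hpq.symm.pos
  have hsum : 1 / p + 1 / q = 1 := by rw [one_div, one_div, hpq.inv_add_inv_eq_one]
  have hrpow : ∀ c : ℝ, 0 ≤ c → c ^ (1 / p) * c ^ (1 / q) = c := fun c hc => by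
    rw [← Real.rpow_add_of_nonneg hc hp0.le hq0.le, hsum, Real.rpow_one]
  have hmul : ∀ c : ℝ, 1 / p * c + 1 / q * c = c := fun c => by rw [← add_mul, hsum, one_mul]
  have hle : ∀ Z : (Matrix (Fin n) (Fin n) ℂ)ˣ, N (matrixAbsPow (X * Y) α) ≤
      N (matrixAbsPow (X * (Z : Matrix (Fin n) (Fin n) ℂ)) (α * p)) ^ (1 / p) *
        N (matrixAbsPow ((Z⁻¹ : (Matrix (Fin n) (Fin n) ℂ)ˣ) * Y) (α * q)) ^ (1 / q) := by
    intro Z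
    have h := N.matrixAbsPow_mul_le_rpow_mul_rpow hpq hα (X * (Z : Matrix (Fin n) (Fin n) ℂ))
      ((Z⁻¹ : (Matrix (Fin n) (Fin n) ℂ)ˣ) * Y)
    rwa [mul_assoc, Units.mul_inv_cancel_left] at h
  have hle' : ∀ Z : (Matrix (Fin n) (Fin n) ℂ)ˣ, N (matrixAbsPow (X * Y) α) ≤
      1 / p * N (matrixAbsPow (X * (Z : Matrix (Fin n) (Fin n) ℂ)) (α * p)) +
        1 / q * N (matrixAbsPow ((Z⁻¹ : (Matrix (Fin n) (Fin n) ℂ)ˣ) * Y) (α * q)) := fun Z =>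
    (hle Z).trans (Real.geom_mean_le_arith_mean2_weighted hp0.le hq0.le (N.nonneg _) (N.nonneg _)
      hsum)
  have hlb : N (matrixAbsPow (X * Y) α) ∈ lowerBounds (Set.range
      fun Z : (Matrix (Fin n) (Fin n) ℂ)ˣ =>
        N (matrixAbsPow (X * (Z : Matrix (Fin n) (Fin n) ℂ)) (α * p)) ^ (1 / p) *
          N (matrixAbsPow ((Z⁻¹ : (Matrix (Fin n) (Fin n) ℂ)ˣ) * Y) (α * q)) ^ (1 / q)) := by
    rintro _ ⟨Z, rfl⟩
    exact hle Z
  have hlb' : N (matrixAbsPow (X * Y) α) ∈ lowerBounds (Set.range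
      fun Z : (Matrix (Fin n) (Fin n) ℂ)ˣ =>
        1 / p * N (matrixAbsPow (X * (Z : Matrix (Fin n) (Fin n) ℂ)) (α * p)) +
          1 / q * N (matrixAbsPow ((Z⁻¹ : (Matrix (Fin n) (Fin n) ℂ)ˣ) * Y) (α * q))) := by
    rintro _ ⟨Z, rfl⟩
    exact hle' Z
  -- It suffices to bound a lower bound `b` by every `c` strictly above the value: if both norms are
  -- at most `c`, so are the product and the sum, the exponents and weights adding to `1`.
  refine ⟨⟨hlb, fun b hb => le_of_forall_gt_imp_ge_of_dense fun c hc => ?_⟩,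
    ⟨hlb', fun b hb => le_of_forall_gt_imp_ge_of_dense fun c hc => ?_⟩, fun hX hY => ?_⟩
  · obtain ⟨Z, h1, h2⟩ := N.exists_matrixAbsPow_le hpq hα X Y hc
    have hc0 : 0 ≤ c := (N.nonneg _).trans h1
    refine (hb ⟨Z, rfl⟩).trans (le_of_le_of_eq ?_ (hrpow c hc0))
    exact mul_le_mul (Real.rpow_le_rpow (N.nonneg _) h1 hp0.le)
      (Real.rpow_le_rpow (N.nonneg _) h2 hq0.le) (Real.rpow_nonneg (N.nonneg _) _)
      (Real.rpow_nonneg hc0 _)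
  · obtain ⟨Z, h1, h2⟩ := N.exists_matrixAbsPow_le hpq hα X Y hc
    refine (hb ⟨Z, rfl⟩).trans (le_of_le_of_eq ?_ (hmul c))
    exact add_le_add (mul_le_mul_of_nonneg_left h1 hp0.le) (mul_le_mul_of_nonneg_left h2 hq0.le)
  · obtain ⟨Z, h1, h2⟩ := N.exists_matrixAbsPow_eq hpq α hX hY
    refine ⟨⟨⟨Z, ?_⟩, hlb⟩, ⟨⟨Z, ?_⟩, hlb'⟩⟩
    · simp only [h1, h2]
      exact hrpow _ (N.nonneg _)
    · simp only [h1, h2]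
      exact hmul _
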